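/- Conventions. Forcing is upwards ($p\le q$ means that $q$ is stronger) and forcing notions are separative preorders: if $p\not\le q$, then some $r\ge q$ is incompatible with $p$. A forcing notion $\mathbb P$ is $\sigma$-distributive if the intersection of countably many dense open subsets of $\mathbb P$ is dense open. $B(\mathbb P)$ denotes the complete Boolean algebra of regular open subsets of $\mathbb P$; as a forcing notion it consists of its nonzero elements, the smaller set being the stronger condition, and $q\in\mathbb P$ is identified with its canonical image in $B(\mathbb P)$. A map $\pi:\mathbb T\to\mathbb B$ is a projection if it is order preserving, for all $t\in\mathbb T$ and $b\ge\pi(t)$ there is $t'\ge t$ with $\pi(t')\ge b$, and the image of $\pi$ is dense in $\mathbb B$. For $b\in B(\mathbb P)$, $D_b(\mathbb P)$ is the filter on $\mathbb P$ generated by the dense open subsets of $\mathbb P$ and the set $\{q\in\mathbb P: q\ge b\}$. Let $\kappa$ be a cardinal, and let $[\kappa]^{<\omega}$, $[\kappa]^n$ denote the sets of strictly increasing sequences of ordinals below $\kappa$ of finite length, respectively of length $n$. A tree of $\kappa$-complete ultrafilters is a family $\vec{\mathcal U}=\langle U_\eta:\eta\in[\kappa]^{<\omega}\rangle$ of $\kappa$-complete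 ultrafilters on $\kappa$ such that $U_\eta$ contains the set of ordinals below $\kappa$ larger than all entries of $\eta$. Conditions of the tree Prikry forcing $\mathbb T_{\vec{\mathcal U}}$ are the pairs $\langle s,T\rangle$ with $s\in T\subseteq[\kappa]^{<\omega}$ such that all $t\in T$ end-extend $s$, $T$ is closed under initial segments that end-extend $s$, and $\{\nu<\kappa: t^\smallfrown\nu\in T\}\in U_t$ for all $t\in T$; a condition $\langle s',T'\rangle$ extends $\langle s,T\rangle$ if $s'\in T$ and $T'\subseteq T$. For $\eta\in[\kappa]^{<\omega}$ and $n\ge1$ the ultrafilter $(U_\eta)_n$ on $[\kappa]^n$ is defined by $(U_\eta)_1=U_\eta$ and $$A\in(U_\eta)_{n+1}\iff\{\gamma\in[\kappa]^n:\{\alpha<\kappa:\gamma^\smallfrown\alpha\in A\}\in U_{\eta^\smallfrown\gamma}\}\in(U_\eta)_n .$$ An ultrafilter $W$ satisfies $W\le_{RK}\vec{\mathcal U}$ if there are $\eta\in[\kappa]^{<\omega}$, $n\ge1$ and a function $g$ on $[\kappa]^n$ with $W=g_*((U_\eta)_n)$. Theorem. Let $\vec{\mathcal U}$ be a tree of $\kappa$-complete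 ultrafilters, let $\mathbb P$ be a $\sigma$-distributive forcing notion of cardinality $\kappa$, and let $\pi:\mathbb T_{\vec{\mathcal U}}\to B(\mathbb P)$ be a projection. Then for every $p\in\mathbb T_{\vec{\mathcal U}}$ there is a $\kappa$-complete ultrafilter $U_p$ on $\mathbb P$ that extends $D_{\pi(p)}(\mathbb P)$ and satisfies $U_p\le_{RK}\vec{\mathcal U}$. -/

import Mathlib

open Cardinal

universe u v

/-! ### Forcing notions

Forcing is upwards: `p ≤ q` means that `q` is the stronger condition. -/

section Forcing

variable {P : Type u} [Preorder P] {Q : Type v} [Preorder Q]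

/-- Two conditions are compatible if they have a common extension. -/
def ForcingCompatible (p q : P) : Prop := ∃ r, p ≤ r ∧ q ≤ r

variable (P) in
/-- If `q` does not extend `p`, then some extension of `q` is incompatible with `p`. -/
def IsSeparative : Prop :=
  ∀ p q : P, ¬ p ≤ q → ∃ r, q ≤ r ∧ ¬ ForcingCompatible p r

/-- Dense open sets of conditions: closed under stronger conditions, and every condition has an
extension in the set. -/
def IsDenseOpen (D : Set P) : Prop := IsUpperSet D ∧ ∀ p, ∃ q ∈ D, p ≤ q

variable (P) in
/-- `lam`-distributivity: the intersection of fewer than `lam` dense open sets is dense open. -/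
def IsDistributive (lam : Cardinal.{u}) : Prop :=
  ∀ 𝒟 : Set (Set P), #𝒟 < lam → (∀ D ∈ 𝒟, IsDenseOpen D) → IsDenseOpen (⋂₀ 𝒟)

variable (P) in
/-- `σ`-distributivity: the intersection of countably many dense open sets is dense open. -/
def IsSigmaDistributive : Prop := IsDistributive P ℵ₁

/-- A projection of forcing notions. -/
structure IsForcingProjection (π : P → Q) : Prop where
  monotone : Monotone π
  lift : ∀ p q, π p ≤ q → ∃ p', p ≤ p' ∧ q ≤ π p'
  dense_range : ∀ q, ∃ p, q ≤ π p

variable (P) in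
/-- The forcing notion `B(P)`: the nonzero elements of the complete Boolean algebra of regular open
subsets of `P`, where the open subsets of `P` are those closed under stronger conditions. An open
set is regular if it contains every `p` above which it is dense. -/
@[ext] structure RegularOpen where
  carrier : Set P
  isUpperSet : IsUpperSet carrier
  regular : ∀ p, (∀ q, p ≤ q → ∃ r, q ≤ r ∧ r ∈ carrier) → p ∈ carrier
  nonempty : carrier.Nonempty

/-- The smaller regular open set is the stronger condition. -/
instance : PartialOrder (RegularOpen P) where
  le b c := c.carrier ⊆ b.carrier
  le_refl _ := subset_rfl
  le_trans _ _ _ h₁ h₂ := h₂.trans h₁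
  le_antisymm _ _ h₁ h₂ := RegularOpen.ext (h₂.antisymm h₁)

/-- The canonical image of `p` in `B(P)`: the regularization of the cone `{q | p ≤ q}` (which is
the cone itself when `P` is separative). -/
def RegularOpen.ofCondition (p : P) : RegularOpen P where
  carrier := {q | ∀ r, q ≤ r → ∃ t, r ≤ t ∧ p ≤ t}
  isUpperSet _ _ hab ha r hr := ha r (hab.trans hr)
  regular a h r hr := by
    obtain ⟨t, hrt, ht⟩ := h r hr
    obtain ⟨w, htw, hw⟩ := ht t le_rfl
    exact ⟨w, hrt.trans htw, hw⟩
  nonempty := ⟨p, fun r hr => ⟨r, le_rfl, hr⟩⟩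

/-- `D_b(P)` for `b ∈ B(P)`: the filter on `P` generated by the dense open subsets of `P` and
the set of all `q ∈ P` which, as elements of `B(P)`, are stronger than `b`. -/
def denseOpenFilterAt (b : RegularOpen P) : Filter P :=
  Filter.generate ({D | IsDenseOpen D} ∪ {{q | b ≤ RegularOpen.ofCondition q}})

end Forcing

/-! ### Trees of ultrafilters and the tree Prikry forcing -/

/-- `[κ]^{<ω}`: the finite strictly increasing sequences of ordinals below `κ`. -/
abbrev IncSeq (κ : Cardinal.{u}) : Type u := {l : List κ.ord.ToType // l.SortedLT}

/-- `[κ]^n`: the strictly increasing sequences of length `n` of ordinals below `κ`. -/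
abbrev IncSeqOfLength (κ : Cardinal.{u}) (n : ℕ) : Type u :=
  {l : List κ.ord.ToType // l.SortedLT ∧ l.length = n}

/-- An ultrafilter closed under intersections of fewer than `κ` of its members. -/
def IsCompleteUltrafilter {α : Type u} (W : Ultrafilter α) (κ : Cardinal.{u}) : Prop :=
  ∀ S : Set (Set α), #S < κ → (∀ A ∈ S, A ∈ W) → ⋂₀ S ∈ W

/-- A tree of `κ`-complete ultrafilters on `κ`, indexed by `[κ]^{<ω}`, where the ultrafilter at `η`
concentrates on the ordinals larger than all entries of `η`. -/
structure UltrafilterTree (κ : Cardinal.{u}) where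
  ult : IncSeq κ → Ultrafilter κ.ord.ToType
  complete : ∀ η, IsCompleteUltrafilter (ult η) κ
  concentrates : ∀ η, {ν | ∀ a ∈ η.1, a < ν} ∈ ult η

/-- Conditions `⟨s, T⟩` of the tree Prikry forcing: `T` is a tree with trunk `s` (all its nodes
end-extend `s`) such that the successors of every node `t ∈ T` form a set in the ultrafilter
at `t`. -/
structure TreePrikry {κ : Cardinal.{u}} (U : UltrafilterTree κ) where
  stem : IncSeq κ
  tree : Set (IncSeq κ)
  stem_mem : stem ∈ tree
  stem_prefix : ∀ t ∈ tree, stem.1 <+: t.1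
  initial_mem : ∀ t ∈ tree, ∀ r : IncSeq κ, stem.1 <+: r.1 → r.1 <+: t.1 → r ∈ tree
  splitting : ∀ t ∈ tree, {ν | ∃ t' ∈ tree, t'.1 = t.1 ++ [ν]} ∈ U.ult t

/-- `⟨s', T'⟩` extends `⟨s, T⟩` if `s' ∈ T` and `T' ⊆ T`. -/
instance {κ : Cardinal.{u}} (U : UltrafilterTree κ) : Preorder (TreePrikry U) where
  le p q := q.stem ∈ p.tree ∧ q.tree ⊆ p.tree
  le_refl p := ⟨p.stem_mem, subset_rfl⟩
  le_trans _ _ _ h₁ h₂ := ⟨h₁.2 h₂.1, h₂.2.trans h₁.2⟩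

/-! ### The iterates `(U_η)_n` -/

namespace UltrafilterTree

variable {κ : Cardinal.{u}} (U : UltrafilterTree κ) (η : IncSeq κ)

/-- `A_γ = {α < κ | γ ⌢ α ∈ A}`. -/
def sectionAt {n : ℕ} (A : Set (IncSeqOfLength κ (n + 1))) (γ : IncSeqOfLength κ n) :
    Set κ.ord.ToType :=
  {α | ∃ γ' ∈ A, γ'.1 = γ.1 ++ [α]}

/-- The set `{γ ∈ [κ]^n | A_γ ∈ U_{η ⌢ γ}}`. -/
def largeSections {n : ℕ} (A : Set (IncSeqOfLength κ (n + 1))) : Set (IncSeqOfLength κ n) :=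
  {γ | ∃ ζ : IncSeq κ, ζ.1 = η.1 ++ γ.1 ∧ sectionAt A γ ∈ U.ult ζ}

/-- The sequences `γ` for which `η ⌢ γ` is still increasing. -/
def above (n : ℕ) : Set (IncSeqOfLength κ n) := {γ | (η.1 ++ γ.1).SortedLT}

theorem mem_of_mem_append {n : ℕ} {ζ : IncSeq κ} {γ : IncSeqOfLength κ n}
    (h : ζ.1 = η.1 ++ γ.1) : {α | (η.1 ++ (γ.1 ++ [α])).SortedLT} ∈ U.ult ζ := by
  refine Filter.mem_of_superset (U.concentrates ζ) fun α hα => ?_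
  have hζ := ζ.2
  simp only [Set.mem_ofPred_eq] at hα ⊢
  rw [← List.append_assoc, ← h, List.sortedLT_iff_pairwise, List.pairwise_append]
  exact ⟨hζ.pairwise, by simp, by simpa using hα⟩

theorem section_univ_mem {n : ℕ} {ζ : IncSeq κ} {γ : IncSeqOfLength κ n}
    (h : ζ.1 = η.1 ++ γ.1) : sectionAt (Set.univ) γ ∈ U.ult ζ := by
  refine Filter.mem_of_superset (U.mem_of_mem_append η h) fun α hα => ?_
  have := hα.pairwise
  rw [List.pairwise_append] at this
  exact ⟨⟨γ.1 ++ [α], this.2.1.sortedLT, by simp [γ.2.2]⟩, trivial, rfl⟩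

theorem section_compl {n : ℕ} (A : Set (IncSeqOfLength κ (n + 1))) (γ : IncSeqOfLength κ n) :
    sectionAt Aᶜ γ = sectionAt Set.univ γ ∩ (sectionAt A γ)ᶜ := by
  ext α
  constructor
  · rintro ⟨γ', h, e⟩
    refine ⟨⟨γ', trivial, e⟩, ?_⟩
    rintro ⟨γ'', h', e'⟩
    exact h (by rwa [Subtype.ext (e.trans e'.symm)])
  · rintro ⟨⟨γ', -, e⟩, h⟩
    exact ⟨γ', fun h' => h ⟨γ', h', e⟩, e⟩

theorem section_inter {n : ℕ} (A B : Set (IncSeqOfLength κ (n + 1))) (γ : IncSeqOfLength κ n) :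
    sectionAt (A ∩ B) γ = sectionAt A γ ∩ sectionAt B γ := by
  ext α
  constructor
  · rintro ⟨γ', h, e⟩
    exact ⟨⟨γ', h.1, e⟩, ⟨γ', h.2, e⟩⟩
  · rintro ⟨⟨γ', h, e⟩, ⟨γ'', h', e'⟩⟩
    obtain rfl : γ' = γ'' := Subtype.ext (e.trans e'.symm)
    exact ⟨γ', ⟨h, h'⟩, e⟩

theorem section_mono {n : ℕ} {A B : Set (IncSeqOfLength κ (n + 1))} (h : A ⊆ B)
    (γ : IncSeqOfLength κ n) : sectionAt A γ ⊆ sectionAt B γ :=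
  fun _ ⟨γ', h', e⟩ => ⟨γ', h h', e⟩

/-- The successor step: `A` is large iff `{γ | A_γ ∈ U_{η ⌢ γ}}` is large for `F`. -/
def succIterate {n : ℕ} (F : Ultrafilter (IncSeqOfLength κ n)) (hF : above η n ∈ F) :
    Ultrafilter (IncSeqOfLength κ (n + 1)) :=
  Ultrafilter.ofComplNotMemIff
    { sets := {A | U.largeSections η A ∈ F}
      univ_sets := by
        refine Filter.mem_of_superset hF fun γ hγ => ?_
        exact ⟨⟨_, hγ⟩, rfl, U.section_univ_mem η rfl⟩
      sets_of_superset := by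
        intro A B hA hAB
        refine Filter.mem_of_superset hA ?_
        rintro γ ⟨ζ, hζ, h⟩
        exact ⟨ζ, hζ, Filter.mem_of_superset h (section_mono hAB γ)⟩
      inter_sets := by
        intro A B hA hB
        refine Filter.mem_of_superset (Filter.inter_mem hA hB) ?_
        rintro γ ⟨⟨ζ, hζ, h⟩, ⟨ζ', hζ', h'⟩⟩
        obtain rfl : ζ = ζ' := Subtype.ext (hζ.trans hζ'.symm)
        exact ⟨ζ, hζ, by rw [section_inter]; exact Filter.inter_mem h h'⟩ } (by
    intro A
    change U.largeSections η Aᶜ ∉ F ↔ U.largeSections η A ∈ F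
    rw [← Ultrafilter.compl_mem_iff_notMem]
    have key : ∀ γ ∈ above η n,
        (γ ∈ (U.largeSections η Aᶜ)ᶜ ↔ γ ∈ U.largeSections η A) := by
      intro γ hγ
      have aux : ∀ B : Set (IncSeqOfLength κ (n + 1)),
          γ ∈ U.largeSections η B ↔ sectionAt B γ ∈ U.ult ⟨_, hγ⟩ := by
        intro B
        constructor
        · rintro ⟨ζ, hζ, h⟩
          obtain rfl : ζ = ⟨_, hγ⟩ := Subtype.ext hζ
          exact h
        · intro h
          exact ⟨_, rfl, h⟩
      rw [Set.mem_compl_iff, aux, aux, section_compl, ← Ultrafilter.compl_mem_iff_notMem]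
      have hu : sectionAt (Set.univ) γ ∈ U.ult ⟨_, hγ⟩ := U.section_univ_mem η rfl
      constructor
      · intro h
        refine Filter.mem_of_superset (Filter.inter_mem h hu) ?_
        rintro α ⟨h₁, h₂⟩
        by_contra h₃
        exact h₁ ⟨h₂, h₃⟩
      · intro h
        exact Filter.mem_of_superset h fun α h₁ h₂ => h₂.2 h₁
    constructor
    · intro h
      exact Filter.mem_of_superset (Filter.inter_mem h hF) fun γ hγ => (key γ hγ.2).1 hγ.1
    · intro h
      exact Filter.mem_of_superset (Filter.inter_mem h hF) fun γ hγ => (key γ hγ.2).2 hγ.1)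

theorem above_mem_succIterate {n : ℕ} (F : Ultrafilter (IncSeqOfLength κ n))
    (hF : above η n ∈ F) : above η (n + 1) ∈ U.succIterate η F hF := by
  change U.largeSections η (above η (n + 1)) ∈ F
  refine Filter.mem_of_superset hF fun γ hγ => ?_
  refine ⟨⟨_, hγ⟩, rfl, Filter.mem_of_superset (U.mem_of_mem_append η rfl) fun α hα => ?_⟩
  have := hα.pairwise
  rw [List.pairwise_append] at this
  exact ⟨⟨γ.1 ++ [α], this.2.1.sortedLT, by simp [γ.2.2]⟩, hα, rfl⟩

/-- The ultrafilters `(U_η)_n` together with the fact that they concentrate on the sequences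
above `η`. The recursion starts with the trivial ultrafilter on `[κ]^0`, so that `(U_η)_1` is
`U_η` (see `mem_iterate_one`). -/
def iterateAux : (n : ℕ) → {F : Ultrafilter (IncSeqOfLength κ n) // above η n ∈ F}
  | 0 => ⟨pure ⟨[], (List.Pairwise.nil).sortedLT, rfl⟩, by
      change ((η.1 ++ [] : List κ.ord.ToType)).SortedLT
      simpa using η.2⟩
  | n + 1 => ⟨U.succIterate η (iterateAux n).1 (iterateAux n).2,
      U.above_mem_succIterate η _ _⟩

/-- `(U_η)_n`, the `n`-th ultrafilter above `η` derived from the tree `U`; an ultrafilter on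
`[κ]^n`. -/
def iterate (n : ℕ) : Ultrafilter (IncSeqOfLength κ n) := (U.iterateAux η n).1

theorem mem_iterate_succ {n : ℕ} (A : Set (IncSeqOfLength κ (n + 1))) :
    A ∈ U.iterate η (n + 1) ↔
      {γ | ∃ ζ : IncSeq κ, ζ.1 = η.1 ++ γ.1 ∧
        {α | ∃ γ' ∈ A, γ'.1 = γ.1 ++ [α]} ∈ U.ult ζ} ∈ U.iterate η n :=
  Iff.rfl

theorem mem_iterate_one (A : Set (IncSeqOfLength κ 1)) :
    A ∈ U.iterate η 1 ↔ {α | ∃ γ ∈ A, γ.1 = [α]} ∈ U.ult η := by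
  rw [mem_iterate_succ]
  change (∃ ζ : IncSeq κ, ζ.1 = η.1 ++ [] ∧ {α | ∃ γ' ∈ A, γ'.1 = [] ++ [α]} ∈ U.ult ζ) ↔ _
  constructor
  · rintro ⟨ζ, hζ, h⟩
    obtain rfl : ζ = η := Subtype.ext (by simpa using hζ)
    exact h
  · intro h
    exact ⟨η, by simp, h⟩

end UltrafilterTree

/-! ### The Rudin–Keisler order -/

/-- `W ≤_RK V`: `W` is the image of `V` under some function. -/
def RudinKeislerLE {α β : Type*} (W : Ultrafilter α) (V : Ultrafilter β) : Prop :=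
  ∃ g : β → α, W = V.map g

/-- `W ≤_RK U⃗`: `W` is Rudin–Keisler below `(U_η)_n` for some `η ∈ [κ]^{<ω}` and some `n ≥ 1`. -/
def RudinKeislerLETree {α : Type*} {κ : Cardinal.{u}} (W : Ultrafilter α)
    (U : UltrafilterTree κ) : Prop :=
  ∃ (η : IncSeq κ) (n : ℕ), 0 < n ∧ RudinKeislerLE W (U.iterate η n)

/-! ### Complete ultrafilters -/

section CompleteUltrafilter

variable {α β : Type u} {κ : Cardinal.{u}}

/-! An atom in `π p` yields a principal ultrafilter, so suppose there is none. Then `κ` is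
uncountable, since a countable σ-distributive forcing notion has atoms above every condition
(`IsSigmaDistributive.exists_atom`).

Code `P` by the ordinals below `κ`. To each node `ζ` of `p` attach the set `forcedBelow` of those
`q`, coded at most by the last entry of `ζ`, which some extension of `p` with trunk `ζ` forces into
the generic filter. It has fewer than `κ` elements, and `κ`-completeness amalgamates fewer than `κ`
extensions with one trunk, so the set has an upper bound `g ζ` in `π p`
(`exists_upperBound_forcedBelow`). The ultrafilter sought is the image under `g` of an iterate above
the trunk of `p`.

It remains to find one length `n` at which almost every `forcedBelow` set meets any given dense open
set (`exists_forcedBelow_meets`). If each `n` had a counterexample `D n`, some direct extension of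
`p` would have all its `forcedBelow` sets disjoint from `⋂ n, D n`. That intersection is dense, so a
further extension forces one of its elements `q`. Without atoms the entries of nodes are unbounded
(`exists_mem_tree_getLast`), so a long enough trunk has last entry at least the code of `q`, a
contradiction. -/

theorem IsCompleteUltrafilter.iInter_mem {W : Ultrafilter α} (hW : IsCompleteUltrafilter W κ)
    {ι : Type u} (hι : #ι < κ) {A : ι → Set α} (hA : ∀ i, A i ∈ W) : ⋂ i, A i ∈ W := by
  rw [← Set.sInter_range]
  exact hW _ (mk_range_le.trans_lt hι) (by rintro _ ⟨i, rfl⟩; exact hA i)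

theorem IsCompleteUltrafilter.iInter_nat_mem {W : Ultrafilter α}
    (hW : IsCompleteUltrafilter W κ) (hκ : ℵ₀ < κ) {A : ℕ → Set α} (hA : ∀ i, A i ∈ W) :
    ⋂ i, A i ∈ W := by
  rw [← Set.sInter_range]
  exact hW _ ((le_aleph0_iff_set_countable.2 (Set.countable_range A)).trans_lt hκ)
    (by rintro _ ⟨i, rfl⟩; exact hA i)

theorem IsCompleteUltrafilter.pure (a : α) : IsCompleteUltrafilter (Pure.pure a) κ :=
  fun _ _ h A hA => h A hA

theorem IsCompleteUltrafilter.map {W : Ultrafilter α} (hW : IsCompleteUltrafilter W κ)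
    (f : α → β) : IsCompleteUltrafilter (W.map f) κ := by
  intro S hS h
  rw [Ultrafilter.mem_map, Set.sInter_eq_iInter, Set.preimage_iInter]
  exact hW.iInter_mem hS fun A => h A.1 A.2

/-- A complete ultrafilter that contains a small set is principal. -/
theorem IsCompleteUltrafilter.exists_singleton_mem {W : Ultrafilter α}
    (hW : IsCompleteUltrafilter W κ) {A : Set α} (hA : #A < κ) (h : A ∈ W) :
    ∃ a ∈ A, {a} ∈ W := by
  by_contra! hn
  have h₁ : ⋂ a : A, ({a.1}ᶜ : Set α) ∈ W :=
    hW.iInter_mem hA fun a => Ultrafilter.compl_mem_iff_notMem.2 (hn a.1 a.2)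
  obtain ⟨a, ha, ha'⟩ := Ultrafilter.nonempty_of_mem (Filter.inter_mem h h₁)
  exact (Set.mem_iInter.1 ha' ⟨a, ha⟩) rfl

end CompleteUltrafilter

theorem mk_Iic_toType_ord_lt {κ : Cardinal.{u}} (hκ : ℵ₀ ≤ κ) (a : κ.ord.ToType) :
    #(Set.Iic a) < κ := by
  rw [← Set.Iio_insert]
  refine mk_insert_le.trans_lt (add_lt_of_lt hκ ((mk_Iio_lt a (by simp)).trans_eq (mk_ord_toType κ)) ?_)
  exact one_lt_aleph0.trans_le hκ

/-! ### The iterated ultrafilters as ultrafilters on the tree of all sequences -/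

namespace UltrafilterTree

variable {κ : Cardinal.{u}} (U : UltrafilterTree κ) (η : IncSeq κ)

/-- The immediate successors of `ζ` that lie in `A`. -/
def succSet (A : Set (IncSeq κ)) (ζ : IncSeq κ) : Set κ.ord.ToType :=
  {α | ∃ ζ' ∈ A, ζ'.1 = ζ.1 ++ [α]}

/-- Witnesses for different indices coincide, as `ζ` and `α` determine the node. An empty index type
must be excluded: `succSet Set.univ ζ` contains only those `α` that keep the sequence increasing. -/
theorem succSet_iInter {ι : Sort v} [Nonempty ι] (A : ι → Set (IncSeq κ)) (ζ : IncSeq κ) :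
    succSet (⋂ i, A i) ζ = ⋂ i, succSet (A i) ζ := by
  ext α
  simp only [Set.mem_iInter]
  constructor
  · rintro ⟨ζ', h, e⟩ i
    exact ⟨ζ', Set.mem_iInter.1 h i, e⟩
  · intro h
    obtain ⟨ζ', -, e⟩ := h (Classical.arbitrary ι)
    refine ⟨ζ', Set.mem_iInter.2 fun i => ?_, e⟩
    obtain ⟨ζ'', h', e'⟩ := h i
    rwa [show ζ' = ζ'' from Subtype.ext (e.trans e'.symm)]

open Classical in
/-- The end-extension `η ⌢ γ`, with a default value if it is not increasing. -/
noncomputable def extend {n : ℕ} (γ : IncSeqOfLength κ n) : IncSeq κ :=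
  if h : (η.1 ++ γ.1).SortedLT then ⟨_, h⟩ else η

theorem extend_val {n : ℕ} {γ : IncSeqOfLength κ n} (h : γ ∈ above η n) :
    (extend η γ).1 = η.1 ++ γ.1 := by
  rw [extend, dif_pos (show (η.1 ++ γ.1).SortedLT from h)]

theorem above_mem_iterate (n : ℕ) : above η n ∈ U.iterate η n := (U.iterateAux η n).2

/-- The image of `(U_η)_n` under `γ ↦ η ⌢ γ`. -/
noncomputable def iterateAt (n : ℕ) : Ultrafilter (IncSeq κ) := (U.iterate η n).map (extend η)

theorem iterateAt_zero : U.iterateAt η 0 = pure η := by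
  change Ultrafilter.map _ (pure _) = _
  rw [Ultrafilter.map_pure]
  congr 1
  refine Subtype.ext ?_
  rw [extend_val]
  · exact List.append_nil _
  · change (η.1 ++ []).SortedLT
    rw [List.append_nil]
    exact η.2

/-- On `IncSeq κ` iterates of all lengths share one type, and the recursion involves only a node and
its own ultrafilter, matching the field `splitting`. The default value of `extend` is harmless
because `above η n` is large. -/
theorem mem_iterateAt_succ {n : ℕ} {A : Set (IncSeq κ)} :
    A ∈ U.iterateAt η (n + 1) ↔ {ζ | succSet A ζ ∈ U.ult ζ} ∈ U.iterateAt η n := by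
  rw [iterateAt, iterateAt, Ultrafilter.mem_map, Ultrafilter.mem_map, mem_iterate_succ]
  refine Filter.congr_sets (Filter.mem_of_superset (U.above_mem_iterate η n) fun γ hγ => ?_)
  have e := extend_val η hγ
  have key : {α | ∃ γ' ∈ (extend η ⁻¹' A : Set (IncSeqOfLength κ (n + 1))), γ'.1 = γ.1 ++ [α]} ∈
      U.ult (extend η γ) ↔
      succSet A (extend η γ) ∈ U.ult (extend η γ) := by
    refine Filter.congr_sets (Filter.mem_of_superset (U.mem_of_mem_append η e) fun α hα => ?_)
    have hα' : (γ.1 ++ [α]).SortedLT := (List.pairwise_append.1 hα.pairwise).2.1.sortedLT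
    let γ' : IncSeqOfLength κ (n + 1) := ⟨γ.1 ++ [α], hα', by simp [γ.2.2]⟩
    have e' : (extend η γ').1 = (extend η γ).1 ++ [α] := by
      rw [extend_val η (show γ' ∈ above η (n + 1) from hα), e, List.append_assoc]
    constructor
    · rintro ⟨δ, h, hδ⟩
      obtain rfl : δ = γ' := Subtype.ext hδ
      exact ⟨_, h, e'⟩
    · rintro ⟨ζ, h, hζ⟩
      obtain rfl : ζ = extend η γ' := Subtype.ext (hζ.trans e'.symm)
      exact ⟨γ', h, rfl⟩
  constructor
  · rintro ⟨ζ, hζ, h⟩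
    obtain rfl : ζ = extend η γ := Subtype.ext (hζ.trans e.symm)
    exact key.1 h
  · intro h
    exact ⟨_, e, key.2 h⟩

theorem iterateAt_complete (n : ℕ) : IsCompleteUltrafilter (U.iterateAt η n) κ := by
  induction n with
  | zero => rw [iterateAt_zero]; exact .pure _
  | succ n ih =>
    intro S hS h
    rcases S.eq_empty_or_nonempty with rfl | hne
    · rw [Set.sInter_empty]
      exact Filter.univ_mem
    have := hne.to_subtype
    rw [Set.sInter_eq_iInter, mem_iterateAt_succ]
    refine Filter.mem_of_superset
      (ih.iInter_mem hS fun A : S => (U.mem_iterateAt_succ η).1 (h A.1 A.2)) fun ζ hζ => ?_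
    simp only [Set.mem_iInter, Set.mem_ofPred_eq] at hζ
    simp only [Set.mem_ofPred_eq, succSet_iInter]
    exact (U.complete ζ).iInter_mem hS hζ

end UltrafilterTree

/-! ### Direct extensions in the tree Prikry forcing -/

namespace TreePrikry

open UltrafilterTree

variable {κ : Cardinal.{u}} {U : UltrafilterTree κ}

/-- The condition with trunk `ζ` obtained by restricting `p` to the nodes above `ζ`. -/
def restrict (p : TreePrikry U) (ζ : IncSeq κ) (hζ : ζ ∈ p.tree) : TreePrikry U where
  stem := ζ
  tree := {t ∈ p.tree | ζ.1 <+: t.1}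
  stem_mem := ⟨hζ, List.prefix_rfl⟩
  stem_prefix _ ht := ht.2
  initial_mem t ht r hr hrt := ⟨p.initial_mem t ht.1 r ((p.stem_prefix ζ hζ).trans hr) hrt, hr⟩
  splitting t ht := Filter.mem_of_superset (p.splitting t ht.1) fun _ ⟨t', ht', e⟩ =>
    ⟨t', ⟨ht', ht.2.trans ⟨_, e.symm⟩⟩, e⟩

theorem le_restrict (p : TreePrikry U) (ζ : IncSeq κ) (hζ : ζ ∈ p.tree) :
    p ≤ p.restrict ζ hζ :=
  ⟨hζ, fun _ h => h.1⟩

theorem tree_mem_iterateAt (p : TreePrikry U) (n : ℕ) : p.tree ∈ U.iterateAt p.stem n := by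
  induction n with
  | zero => rw [iterateAt_zero]; exact p.stem_mem
  | succ n ih =>
    rw [mem_iterateAt_succ]
    exact Filter.mem_of_superset ih p.splitting

/-- Fewer than `κ` direct extensions of a condition have a common direct extension. -/
theorem exists_le_of_stem_eq {ι : Type u} (hι : #ι < κ) (p : TreePrikry U)
    (t : ι → TreePrikry U) (ht : ∀ i, p ≤ t i) (hs : ∀ i, (t i).stem = p.stem) :
    ∃ q, p ≤ q ∧ q.stem = p.stem ∧ ∀ i, t i ≤ q := by
  rcases isEmpty_or_nonempty ι with h | h
  · exact ⟨p, le_rfl, rfl, fun i => h.elim i⟩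
  have hsub : ∀ i, (⋂ i, (t i).tree) ⊆ (t i).tree := fun i => Set.iInter_subset _ i
  have hst : p.stem ∈ ⋂ i, (t i).tree := Set.mem_iInter.2 fun i => hs i ▸ (t i).stem_mem
  have hp : (⋂ i, (t i).tree) ⊆ p.tree := (hsub (Classical.arbitrary ι)).trans (ht _).2
  refine ⟨⟨p.stem, ⋂ i, (t i).tree, hst, fun s h => p.stem_prefix s (hp h), ?_, ?_⟩,
    ⟨p.stem_mem, hp⟩, rfl, fun i => ⟨hst |> Set.mem_iInter.1 <| i, hsub i⟩⟩
  · intro s h r hr hrs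
    exact Set.mem_iInter.2 fun i =>
      (t i).initial_mem s (hsub i h) r (by rw [hs i]; exact hr) hrs
  · intro s h
    change succSet (⋂ i, (t i).tree) s ∈ U.ult s
    rw [succSet_iInter]
    exact (U.complete s).iInter_mem hι fun i => (t i).splitting s (hsub i h)

/-- If `A` contains the trunk of `p` and almost all sequences of each length above it, then some
direct extension of `p` has all its nodes in `A`. -/
theorem exists_le_tree_subset (hκ : ℵ₀ < κ) (p : TreePrikry U) {A : Set (IncSeq κ)}
    (hA : ∀ n, A ∈ U.iterateAt p.stem n) : ∃ q, p ≤ q ∧ q.stem = p.stem ∧ q.tree ⊆ A := by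
  -- Each stage discards the nodes without a large set of successors in the previous one; largeness
  -- at length `n` uses the previous stage at `n` and `n + 1`. By countable completeness the limit
  -- splits into itself.
  let H : ℕ → Set (IncSeq κ) := fun k =>
    Nat.rec (A ∩ p.tree) (fun _ X => X ∩ {ζ | succSet X ζ ∈ U.ult ζ}) k
  have hH : ∀ k n, H k ∈ U.iterateAt p.stem n := by
    intro k
    induction k with
    | zero => exact fun n => Filter.inter_mem (hA n) (p.tree_mem_iterateAt n)
    | succ k ih =>
      exact fun n => Filter.inter_mem (ih n) ((U.mem_iterateAt_succ _).1 (ih (n + 1)))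
  have hsplit : ∀ ζ ∈ ⋂ k, H k, succSet (⋂ k, H k) ζ ∈ U.ult ζ := by
    intro ζ hζ
    rw [succSet_iInter]
    exact (U.complete ζ).iInter_nat_mem hκ fun k => (Set.mem_iInter.1 hζ (k + 1)).2
  have hstem : p.stem ∈ ⋂ k, H k := Set.mem_iInter.2 fun k => by
    have := hH k 0
    rwa [iterateAt_zero] at this
  have hsub : (⋂ k, H k) ⊆ A ∩ p.tree := Set.iInter_subset H 0
  have hself : ∀ {t : IncSeq κ}, (p.stem.1 <+: t.1 ∧
      ∀ r : IncSeq κ, p.stem.1 <+: r.1 → r.1 <+: t.1 → r ∈ ⋂ k, H k) → t ∈ ⋂ k, H k :=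
    fun h => h.2 _ h.1 List.prefix_rfl
  -- The limit need not be closed under initial segments, so only nodes reached entirely inside it
  -- are kept. A successor of such a node has one new initial segment, itself.
  refine ⟨⟨p.stem, {t | p.stem.1 <+: t.1 ∧
      ∀ r : IncSeq κ, p.stem.1 <+: r.1 → r.1 <+: t.1 → r ∈ ⋂ k, H k},
    ⟨List.prefix_rfl, fun r h₁ h₂ => ?_⟩, fun _ h => h.1,
    fun t ht r h₁ h₂ => ⟨h₁, fun r' h₃ h₄ => ht.2 r' h₃ (h₄.trans h₂)⟩, fun t ht => ?_⟩,
    ⟨p.stem_mem, fun t ht => (hsub (hself ht)).2⟩, rfl, fun t ht => (hsub (hself ht)).1⟩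
  · rwa [show r = p.stem from Subtype.ext (List.Sublist.antisymm h₂.sublist h₁.sublist)]
  · refine Filter.mem_of_superset (hsplit t (hself ht)) ?_
    rintro ν ⟨t', ht', e⟩
    refine ⟨t', ⟨ht.1.trans ⟨_, e.symm⟩, fun r h₁ h₂ => ?_⟩, e⟩
    rw [e, List.prefix_concat_iff, ← e] at h₂
    rcases h₂ with h₂ | h₂
    · rwa [show r = t' from Subtype.ext h₂]
    · exact ht.2 r h₁ h₂

/-- A condition has nodes of every length above that of a given node. -/
theorem exists_mem_tree_length (p : TreePrikry U) {s : IncSeq κ} (hs : s ∈ p.tree) (n : ℕ) :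
    ∃ t ∈ p.tree, s.1 <+: t.1 ∧ t.1.length = s.1.length + n := by
  induction n with
  | zero => exact ⟨s, hs, List.prefix_rfl, rfl⟩
  | succ n ih =>
    obtain ⟨t, ht, h₁, h₂⟩ := ih
    obtain ⟨ν, t', ht', e⟩ := Ultrafilter.nonempty_of_mem (p.splitting t ht)
    exact ⟨t', ht', h₁.trans ⟨_, e.symm⟩, by simp [e, h₂, add_assoc]⟩

/-- If the ultrafilters at all nodes of `p` are principal, then `p` has an extension above which
any two conditions are compatible. -/
theorem exists_compatible_above (p : TreePrikry U)
    (h : ∀ t ∈ p.tree, ∃ ν, {ν} ∈ U.ult t) :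
    ∃ q, p ≤ q ∧ ∀ q₁ q₂, q ≤ q₁ → q ≤ q₂ → ForcingCompatible q₁ q₂ := by
  have huniq : ∀ t ν ν', {ν} ∈ U.ult t → {ν'} ∈ U.ult t → ν = ν' := by
    intro t ν ν' h₁ h₂
    obtain ⟨a, ha, ha'⟩ := Ultrafilter.nonempty_of_mem (Filter.inter_mem h₁ h₂)
    exact (Set.mem_singleton_iff.1 ha).symm.trans ha'
  -- The nodes reached from the trunk by always choosing the point on which the ultrafilter
  -- concentrates: a single branch, with at most one node of each length (`hcomp`).
  let T : Set (IncSeq κ) := {t ∈ p.tree | ∀ (r : IncSeq κ) (ν : κ.ord.ToType),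
    p.stem.1 <+: r.1 → r.1 ++ [ν] <+: t.1 → {ν} ∈ U.ult r}
  let q : TreePrikry U := ⟨p.stem, T, ⟨p.stem_mem, fun r ν h₁ h₂ => by
      have := h₁.length_le.trans_lt (Nat.lt_succ_self _)
      have := h₂.length_le
      simp at this
      omega⟩, fun t ht => p.stem_prefix t ht.1,
    fun t ht r h₁ h₂ => ⟨p.initial_mem t ht.1 r h₁ h₂,
      fun r' ν h₃ h₄ => ht.2 r' ν h₃ (h₄.trans h₂)⟩, fun t ht => by
      obtain ⟨ν, hν⟩ := h t ht.1
      refine Filter.mem_of_superset (Filter.inter_mem hν (p.splitting t ht.1)) ?_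
      rintro ν' ⟨rfl, t', ht', e⟩
      refine ⟨t', ⟨ht', fun r ν h₁ h₂ => ?_⟩, e⟩
      rw [e, List.prefix_concat_iff] at h₂
      rcases h₂ with h₂ | h₂
      · obtain ⟨h₃, h₄⟩ := List.append_inj' h₂ rfl
        obtain rfl : r = t := Subtype.ext h₃
        rw [List.singleton_inj] at h₄
        rwa [h₄]
      · exact ht.2 r ν h₁ h₂⟩
  have hcomp : ∀ (n : ℕ) (t t' : IncSeq κ), t ∈ T → t' ∈ T →
      t.1.length = p.stem.1.length + n → t'.1.length = t.1.length → t = t' := by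
    intro n
    induction n with
    | zero =>
      intro t t' ht ht' h₁ h₂
      have e := (p.stem_prefix t ht.1).eq_of_length (by omega)
      have e' := (p.stem_prefix t' ht'.1).eq_of_length (by omega)
      exact Subtype.ext (e.symm.trans e')
    | succ n ih =>
      have split : ∀ t ∈ T, t.1.length = p.stem.1.length + (n + 1) → ∃ (r : IncSeq κ)
          (ν : κ.ord.ToType), t.1 = r.1 ++ [ν] ∧ r ∈ T ∧ r.1.length = p.stem.1.length + n ∧
          {ν} ∈ U.ult r := by
        intro t ht hl
        rcases List.eq_nil_or_concat' t.1 with h₀ | ⟨l, ν, e⟩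
        · simp [h₀] at hl
        have hl' : l.length = p.stem.1.length + n := by
          simp [e] at hl
          omega
        have hpre : l <+: t.1 := ⟨_, e.symm⟩
        let r : IncSeq κ := ⟨l, (t.2.pairwise.sublist hpre.sublist).sortedLT⟩
        have hr : p.stem.1 <+: r.1 :=
          List.prefix_of_prefix_length_le (p.stem_prefix t ht.1) hpre
            (hl'.symm ▸ Nat.le_add_right _ _)
        exact ⟨r, ν, e, q.initial_mem t ht r hr hpre, hl',
          ht.2 r ν hr (by rw [e])⟩
      intro t t' ht ht' h₁ h₂
      obtain ⟨r, ν, e, hr, hl, hν⟩ := split t ht h₁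
      obtain ⟨r', ν', e', hr', hl', hν'⟩ := split t' ht' (h₂.trans h₁)
      obtain rfl := ih r r' hr hr' hl (hl'.trans hl.symm)
      obtain rfl := huniq r ν ν' hν hν'
      exact Subtype.ext (e.trans e'.symm)
  -- An extension of `q` has a node of every length from its trunk on, and on a single branch that
  -- node is `t`. So extensions of `q` are linearly ordered by trunk length.
  have hmem : ∀ (q₁ : TreePrikry U), q ≤ q₁ → ∀ t ∈ T, q₁.stem.1.length ≤ t.1.length →
      t ∈ q₁.tree := by
    intro q₁ h₁ t ht hl
    obtain ⟨t', ht', -, e⟩ :=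
      q₁.exists_mem_tree_length q₁.stem_mem (t.1.length - q₁.stem.1.length)
    have hl' := (p.stem_prefix t ht.1).length_le
    rwa [hcomp (t.1.length - p.stem.1.length) t t' ht (h₁.2 ht') (by omega) (by omega)]
  have hle : ∀ q₁ q₂, q ≤ q₁ → q ≤ q₂ → q₁.stem.1.length ≤ q₂.stem.1.length → q₁ ≤ q₂ := by
    intro q₁ q₂ h₁ h₂ hl
    exact ⟨hmem q₁ h₁ _ h₂.1 hl, fun t ht =>
      hmem q₁ h₁ t (h₂.2 ht) (hl.trans (q₂.stem_prefix t ht).length_le)⟩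
  refine ⟨q, ⟨p.stem_mem, fun t ht => ht.1⟩, fun q₁ q₂ h₁ h₂ => ?_⟩
  rcases le_total q₁.stem.1.length q₂.stem.1.length with hl | hl
  · exact ⟨q₂, hle q₁ q₂ h₁ h₂ hl, le_rfl⟩
  · exact ⟨q₁, le_rfl, hle q₂ q₁ h₂ h₁ hl⟩

end TreePrikry

/-! ### Regular open sets and atoms -/

section Forcing

variable {P : Type u} [Preorder P]

theorem RegularOpen.ofCondition_carrier (hsep : IsSeparative P) (p : P) :
    (RegularOpen.ofCondition p).carrier = Set.Ici p := by
  ext q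
  constructor
  · intro h
    by_contra hn
    obtain ⟨r, hr, hc⟩ := hsep p q hn
    obtain ⟨t, h₁, h₂⟩ := h r hr
    exact hc ⟨t, h₂, h₁⟩
  · exact fun h r hr => ⟨r, le_rfl, le_trans h hr⟩

theorem RegularOpen.le_ofCondition_iff (hsep : IsSeparative P) {b : RegularOpen P} {q : P} :
    b ≤ RegularOpen.ofCondition q ↔ q ∈ b.carrier := by
  change (RegularOpen.ofCondition q).carrier ⊆ b.carrier ↔ _
  rw [ofCondition_carrier hsep]
  exact ⟨fun h => h (Set.mem_Ici.2 le_rfl), fun h r hr => b.isUpperSet hr h⟩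

theorem RegularOpen.le_of_ofCondition_le (hsep : IsSeparative P) {b : RegularOpen P} {q r : P}
    (h : RegularOpen.ofCondition q ≤ b) (hr : r ∈ b.carrier) : q ≤ r := by
  have := h hr
  rwa [ofCondition_carrier hsep] at this

/-- A condition with no stronger condition lies in every dense open set. -/
theorem IsDenseOpen.mem_of_atom {D : Set P} (hD : IsDenseOpen D) {r : P}
    (hr : ∀ r', r ≤ r' → r' ≤ r) : r ∈ D := by
  obtain ⟨q, hq, h⟩ := hD.2 r
  exact hD.1 (hr q h) hq

theorem IsSigmaDistributive.iInter_nat (hdist : IsSigmaDistributive P) {D : ℕ → Set P}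
    (hD : ∀ n, IsDenseOpen (D n)) : IsDenseOpen (⋂ n, D n) := by
  rw [← Set.sInter_range]
  exact hdist _ ((le_aleph0_iff_set_countable.2 (Set.countable_range D)).trans_lt
    aleph0_lt_aleph_one) (by rintro _ ⟨n, rfl⟩; exact hD n)

/-- In a countable `σ`-distributive forcing notion every condition has an atom above it. -/
theorem IsSigmaDistributive.exists_atom (hdist : IsSigmaDistributive P)
    (hcard : #P ≤ ℵ₀) (p : P) : ∃ r, p ≤ r ∧ ∀ r', r ≤ r' → r' ≤ r := by
  -- `E q` decides `q`. A condition deciding every `q` is an atom, since it is compatible with each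
  -- of its extensions.
  let E : P → Set P := fun q => {r | q ≤ r ∨ ¬ ForcingCompatible q r}
  have hE : ∀ q, IsDenseOpen (E q) := by
    intro q
    constructor
    · rintro a b hab (h | h)
      · exact Or.inl (h.trans hab)
      · exact Or.inr fun ⟨t, h₁, h₂⟩ => h ⟨t, h₁, hab.trans h₂⟩
    · intro r
      by_cases h : ForcingCompatible q r
      · obtain ⟨t, h₁, h₂⟩ := h
        exact ⟨t, Or.inl h₁, h₂⟩
      · exact ⟨r, Or.inr h, le_rfl⟩
  have hI : IsDenseOpen (⋂₀ Set.range E) :=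
    hdist _ ((mk_range_le.trans hcard).trans_lt aleph0_lt_aleph_one)
      (by rintro _ ⟨q, rfl⟩; exact hE q)
  obtain ⟨r, hr, hpr⟩ := hI.2 p
  refine ⟨r, hpr, fun r' h => ?_⟩
  exact (hr (E r') ⟨r', rfl⟩).resolve_right fun hn => hn ⟨r', le_rfl, h⟩

/-- The image under a projection of a condition above which all conditions are compatible
consists of atoms. -/
theorem IsForcingProjection.le_of_mem_carrier {Q : Type v} [Preorder Q] {π : Q → RegularOpen P}
    (hπ : IsForcingProjection π) (hsep : IsSeparative P) {q : Q}
    (hq : ∀ q₁ q₂, q ≤ q₁ → q ≤ q₂ → ForcingCompatible q₁ q₂) {r r' : P}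
    (hr : r ∈ (π q).carrier) (h : r ≤ r') : r' ≤ r := by
  by_contra hn
  -- The incompatible conditions `w` and `r'` both lie in `π q`, so they lift to extensions of `q`,
  -- whose compatibility projects to that of `w` and `r'`.
  obtain ⟨w, hw, hc⟩ := hsep r' r hn
  obtain ⟨q₁, h₁, e₁⟩ := hπ.lift q (RegularOpen.ofCondition w)
    ((RegularOpen.le_ofCondition_iff hsep).2 ((π q).isUpperSet hw hr))
  obtain ⟨q₂, h₂, e₂⟩ := hπ.lift q (RegularOpen.ofCondition r')
    ((RegularOpen.le_ofCondition_iff hsep).2 ((π q).isUpperSet h hr))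
  obtain ⟨q₃, h₃, h₄⟩ := hq q₁ q₂ h₁ h₂
  obtain ⟨t, ht⟩ := (π q₃).nonempty
  exact hc ⟨t, RegularOpen.le_of_ofCondition_le hsep (e₂.trans (hπ.monotone h₄)) ht,
    RegularOpen.le_of_ofCondition_le hsep (e₁.trans (hπ.monotone h₃)) ht⟩

theorem le_denseOpenFilterAt (hsep : IsSeparative P) {b : RegularOpen P} {W : Ultrafilter P}
    (hD : ∀ D, IsDenseOpen D → D ∈ W) (hb : b.carrier ∈ W) :
    (W : Filter P) ≤ denseOpenFilterAt b := by
  rw [denseOpenFilterAt, Filter.le_generate_iff]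
  rintro D (h | rfl)
  · exact hD D h
  · refine Filter.mem_of_superset hb fun q hq => ?_
    exact (RegularOpen.le_ofCondition_iff hsep).2 hq

end Forcing

/-! ### Rudin–Keisler reductions to the tree -/

theorem rudinKeislerLETree_pure {α : Type v} {κ : Cardinal.{u}} (U : UltrafilterTree κ) (a : α) :
    RudinKeislerLETree (pure a : Ultrafilter α) U := by
  refine ⟨⟨[], List.Pairwise.nil.sortedLT⟩, 1, one_pos, fun _ => a, ?_⟩
  ext A
  rw [Ultrafilter.mem_map, Ultrafilter.mem_pure]
  by_cases h : a ∈ A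
  · simp only [h, Set.preimage_const_of_mem, true_iff]
    exact Filter.univ_mem
  · simp only [h, not_false_eq_true, Set.preimage_const_of_notMem, false_iff]
    exact Ultrafilter.empty_notMem

/-- Length `0` is not allowed in the definition, but there the image is principal and a constant
function on length `1` serves. -/
theorem rudinKeislerLETree_map_iterateAt {α : Type v} {κ : Cardinal.{u}} (U : UltrafilterTree κ)
    (η : IncSeq κ) (n : ℕ) (g : IncSeq κ → α) :
    RudinKeislerLETree ((U.iterateAt η n).map g) U := by
  rcases n.eq_zero_or_pos with rfl | hn
  · rw [U.iterateAt_zero, Ultrafilter.map_pure]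
    exact rudinKeislerLETree_pure U _
  · exact ⟨η, n, hn, g ∘ UltrafilterTree.extend η, Ultrafilter.map_map _ _ _⟩

/-! ### The ultrafilter on the projected forcing notion -/

namespace TreePrikry

variable {κ : Cardinal.{u}} {U : UltrafilterTree κ} {P : Type u} [Preorder P]

/-- The conditions, coded below the last entry of `ζ`, that are forced to lie in the generic
filter by some extension of `p` with trunk `ζ`. -/
def forcedBelow (π : TreePrikry U → RegularOpen P) (e : P → κ.ord.ToType) (p : TreePrikry U)
    (ζ : IncSeq κ) : Set P :=
  {q | (∃ t, p ≤ t ∧ t.stem = ζ ∧ RegularOpen.ofCondition q ≤ π t) ∧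
    ∃ a ∈ ζ.1.getLast?, e q ≤ a}

theorem mk_forcedBelow_lt (hκ : ℵ₀ ≤ κ) (π : TreePrikry U → RegularOpen P)
    {e : P → κ.ord.ToType} (he : e.Injective) (p : TreePrikry U) (ζ : IncSeq κ) :
    #(forcedBelow π e p ζ) < κ := by
  rcases h : ζ.1.getLast? with _ | a
  · have : forcedBelow π e p ζ = ∅ := by
      ext q
      simp [forcedBelow, h]
    rw [this, mk_eq_zero]
    exact aleph0_pos.trans_le hκ
  · refine lt_of_le_of_lt ?_ (mk_Iic_toType_ord_lt hκ a)
    refine mk_le_of_injective (f := fun q => ⟨e q.1, ?_⟩) ?_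
    · obtain ⟨-, b, hb, hq⟩ := q.2
      rw [h, Option.mem_some_iff] at hb
      rwa [hb]
    · intro q q' hqq
      exact Subtype.ext (he (congrArg Subtype.val hqq))

theorem exists_upperBound_forcedBelow (hκ : ℵ₀ ≤ κ) (hsep : IsSeparative P)
    {π : TreePrikry U → RegularOpen P} (hπ : IsForcingProjection π) {e : P → κ.ord.ToType}
    (he : e.Injective) (p : TreePrikry U) {ζ : IncSeq κ} (hζ : ζ ∈ p.tree) :
    ∃ r ∈ (π p).carrier, ∀ q ∈ forcedBelow π e p ζ, q ≤ r := by
  choose t h₁ h₂ h₃ using fun q : forcedBelow π e p ζ => q.2.1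
  -- The witnesses extend `p` with trunk `ζ`, hence are direct extensions of `p.restrict ζ hζ` and
  -- can be amalgamated.
  obtain ⟨s, hs, -, hts⟩ := exists_le_of_stem_eq (mk_forcedBelow_lt hκ π he p ζ)
    (p.restrict ζ hζ) t
    (fun q => ⟨⟨(h₁ q).2 (t q).stem_mem, by rw [h₂ q]⟩, fun x hx =>
      ⟨(h₁ q).2 hx, h₂ q ▸ (t q).stem_prefix x hx⟩⟩) h₂
  obtain ⟨r, hr⟩ := (π s).nonempty
  exact ⟨r, hπ.monotone ((p.le_restrict ζ hζ).trans hs) hr, fun q hq =>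
    RegularOpen.le_of_ofCondition_le hsep ((h₃ ⟨q, hq⟩).trans (hπ.monotone (hts ⟨q, hq⟩))) hr⟩

/-- If `π p` contains no atom, then the entries of the nodes of every extension of `p` are
unbounded in `κ`. -/
theorem exists_mem_tree_getLast (hκ : ℵ₀ ≤ κ) (hsep : IsSeparative P)
    {π : TreePrikry U → RegularOpen P} (hπ : IsForcingProjection π) {p : TreePrikry U}
    (hat : ∀ r ∈ (π p).carrier, ∃ r', r ≤ r' ∧ ¬ r' ≤ r) (β : κ.ord.ToType) :
    ∃ t ∈ p.tree, ∃ a ∈ t.1.getLast?, β ≤ a := by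
  by_contra! hn
  -- A bound `β` on the entries puts a set of size less than `κ` into the ultrafilter at each node,
  -- making all of them principal.
  obtain ⟨q, hpq, hq⟩ := p.exists_compatible_above fun t ht => by
    refine (((U.complete t).exists_singleton_mem (mk_Iic_toType_ord_lt hκ β)
      (Filter.mem_of_superset (p.splitting t ht) ?_))).imp fun _ h => h.2
    rintro ν ⟨t', ht', e⟩
    exact (hn t' ht' ν (by simp [e])).le
  obtain ⟨r, hr⟩ := (π q).nonempty
  obtain ⟨r', h, h'⟩ := hat r (hπ.monotone hpq hr)
  exact h' (hπ.le_of_mem_carrier hsep hq hr h)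

/-- For some `n`, every dense open set contains a condition forced by almost all trunks of
length `n` above the trunk of `p`. -/
theorem exists_forcedBelow_meets (hκ : ℵ₀ < κ) (hsep : IsSeparative P)
    (hdist : IsSigmaDistributive P) {π : TreePrikry U → RegularOpen P}
    (hπ : IsForcingProjection π) (e : P → κ.ord.ToType) (p : TreePrikry U)
    (hat : ∀ r ∈ (π p).carrier, ∃ r', r ≤ r' ∧ ¬ r' ≤ r) :
    ∃ n, ∀ D, IsDenseOpen D →
      {ζ | ∃ q ∈ forcedBelow π e p ζ, q ∈ D} ∈ U.iterateAt p.stem n := by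
  by_contra! hn
  choose D hD hDn using hn
  have hI := hdist.iInter_nat hD
  obtain ⟨p', hpp', -, hA⟩ := p.exists_le_tree_subset hκ
    (A := {ζ | ∀ q ∈ forcedBelow π e p ζ, q ∉ ⋂ n, D n}) fun n => by
      refine Filter.mem_of_superset (Ultrafilter.compl_mem_iff_notMem.2 (hDn n)) ?_
      exact fun ζ hζ q hq hqD => hζ ⟨q, hq, Set.mem_iInter.1 hqD n⟩
  obtain ⟨r, hr⟩ := (π p').nonempty
  obtain ⟨q, hqD, hrq⟩ := hI.2 r
  obtain ⟨s, hs, hqs⟩ := hπ.lift p' (RegularOpen.ofCondition q)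
    ((RegularOpen.le_ofCondition_iff hsep).2 ((π p').isUpperSet hrq hr))
  -- The node must be found in `s`, not in `p'`: restricting `s` to it keeps `q` forced while its
  -- last entry reaches the code of `q`.
  obtain ⟨t, ht, hlast⟩ := s.exists_mem_tree_getLast hκ.le hsep hπ
    (fun r hr => hat r (hπ.monotone (hpp'.trans hs) hr)) (e q)
  exact hA (hs.2 ht) q ⟨⟨s.restrict t ht, (hpp'.trans hs).trans (s.le_restrict t ht), rfl,
    hqs.trans (hπ.monotone (s.le_restrict t ht))⟩, hlast⟩ hqD

end TreePrikry

theorem mainTheorem2 {κ : Cardinal.{u}} (U : UltrafilterTree κ)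
    {P : Type u} [Preorder P] (hsep : IsSeparative P) (hdist : IsSigmaDistributive P)
    (hcard : #P = κ) (π : TreePrikry U → RegularOpen P) (hπ : IsForcingProjection π)
    (p : TreePrikry U) :
    ∃ W : Ultrafilter P, IsCompleteUltrafilter W κ ∧
      (W : Filter P) ≤ denseOpenFilterAt (π p) ∧ RudinKeislerLETree W U := by
  by_cases hat : ∃ r ∈ (π p).carrier, ∀ r', r ≤ r' → r' ≤ r
  · obtain ⟨r, hr, hr'⟩ := hat
    exact ⟨pure r, .pure r, le_denseOpenFilterAt hsep (fun D hD => hD.mem_of_atom hr') hr,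
      rudinKeislerLETree_pure U r⟩
  have hκ : ℵ₀ < κ := by
    by_contra! h
    obtain ⟨r, hr⟩ := (π p).nonempty
    obtain ⟨r', h₁, h₂⟩ := hdist.exists_atom (hcard.trans_le h) r
    exact hat ⟨r', (π p).isUpperSet h₁ hr, h₂⟩
  push Not at hat
  obtain ⟨e⟩ : Nonempty (P ≃ κ.ord.ToType) := Cardinal.eq.1 (hcard.trans (mk_ord_toType κ).symm)
  obtain ⟨n, hn⟩ := p.exists_forcedBelow_meets hκ hsep hdist hπ e hat
  have : Nonempty P := (π p).nonempty.nonempty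
  -- Values of `g` off `p.tree` are arbitrary, which does not matter since `p.tree` is large for
  -- every iterate above its trunk.
  choose! g hg hle using fun ζ (hζ : ζ ∈ p.tree) =>
    p.exists_upperBound_forcedBelow hκ.le hsep hπ e.injective hζ
  refine ⟨(U.iterateAt p.stem n).map g, (U.iterateAt_complete p.stem n).map g,
    le_denseOpenFilterAt hsep (fun D hD => ?_) ?_, rudinKeislerLETree_map_iterateAt U _ n g⟩
  · rw [Ultrafilter.mem_map]
    refine Filter.mem_of_superset (Filter.inter_mem (p.tree_mem_iterateAt n) (hn D hD)) ?_
    rintro ζ ⟨hζ, q, hq, hqD⟩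
    exact hD.1 (hle ζ hζ q hq) hqD
  · rw [Ultrafilter.mem_map]
    exact Filter.mem_of_superset (p.tree_mem_iterateAt n) hg
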